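/- Let $\mathrm{SmMan}$ be the category whose objects are smooth real manifolds (Hausdorff, second countable, without boundary, each of one fixed finite dimension $\dim M\in\mathbb N$, i.e. with charts in $\mathbb R^{\dim M}$) and whose morphisms are the smooth ($C^\infty$) maps. Let $r : A \to B$ be a retraction in $\mathrm{SmMan}$, i.e. a smooth map for which there is a smooth map $s : B \to A$ with $r\circ s=\mathrm{id}_B$, and let $f : C \to B$ be any smooth map with $C$ non-empty. If a pullback $A\times_B C$ of $r$ and $f$ exists in $\mathrm{SmMan}$ (in the sense of the categorical universal property), then $$\dim(A\times_B C)=\dim A+\dim C-\dim B .$$ -/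

import Mathlib

open CategoryTheory
open scoped Manifold ContDiff

universe u

/-- A smooth real manifold: a Hausdorff, second countable topological space with a smooth
(`C^∞`) atlas modelled on `ℝ^dim`, without boundary. As usual, all charts of one manifold take
values in the same `ℝ^dim`. The empty manifold is allowed (in every dimension). -/
structure SmMan : Type (u + 1) where
  /-- The underlying set. -/
  carrier : Type u
  /-- The dimension of the manifold. -/
  dim : ℕ
  [topologicalSpace : TopologicalSpace carrier]
  [t2Space : T2Space carrier]
  [secondCountable : SecondCountableTopology carrier]
  [chartedSpace : ChartedSpace (EuclideanSpace ℝ (Fin dim)) carrier]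
  [isManifold : IsManifold (𝓡 dim) ∞ carrier]

namespace SmMan

instance : CoeSort SmMan.{u} (Type u) := ⟨SmMan.carrier⟩

attribute [instance] topologicalSpace t2Space secondCountable chartedSpace isManifold

/-- Morphisms of smooth manifolds: `C^∞` maps. -/
@[ext]
structure Hom (M N : SmMan.{u}) where
  /-- The underlying map. -/
  toFun : M → N
  contMDiff : ContMDiff (𝓡 M.dim) (𝓡 N.dim) ∞ toFun

/-- The category of smooth real manifolds and smooth maps. -/
instance : Category SmMan.{u} where
  Hom M N := Hom M N
  id M := ⟨id, contMDiff_id⟩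
  comp f g := ⟨g.toFun ∘ f.toFun, g.contMDiff.comp f.contMDiff⟩

end SmMan

open Set Filter Topology

/-! A retraction is a submersion only near the image of its section `s`, so the dimension is
computed at one well-chosen point. Lifting `(f ≫ s, 𝟙 C)` to `P` gives a point `p` over `(s (f c),
c)`. Near `s (f c)` the map `r` looks like a projection with fibre `ℝ^k`, where `k = dim A - dim B`
(`exists_local_product_of_section`), so the fibre product near `p` should look like `C × ℝ^k`. Only
the universal property of `P` is known. Constant maps show that points of `P` are determined by
their projections, and Euclidean test objects turn the expected local parametrization into a smooth
map into `P`. Its local inverse is smooth at `p`, so the derivatives are mutually inverse and `dim P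
= dim C + k`. -/

/-- If `f` is smooth on an open set and its derivative at a point is surjective, then near that
point `f` is, up to a smooth change of coordinates, the first projection of a product. -/
theorem exists_smooth_coordinates_of_surjective_fderiv {E F : Type*} [NormedAddCommGroup E]
    [NormedSpace ℝ E] [FiniteDimensional ℝ E] [NormedAddCommGroup F] [NormedSpace ℝ F]
    [FiniteDimensional ℝ F] {f : E → F} {U : Set E} (hU : IsOpen U) {x : E} (hx : x ∈ U)
    (hf : ContDiffOn ℝ ∞ f U) (hsurj : (fderiv ℝ f x).range = ⊤) :
    ∃ k : ℕ, k + Module.finrank ℝ F = Module.finrank ℝ E ∧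
      ∃ Φ : OpenPartialHomeomorph E (F × EuclideanSpace ℝ (Fin k)), x ∈ Φ.source ∧
        Φ.source ⊆ U ∧ (∀ y, (Φ y).1 = f y) ∧ ContDiffOn ℝ ∞ Φ Φ.source ∧
        ContDiffOn ℝ ∞ Φ.symm Φ.target := by
  have : CompleteSpace E := FiniteDimensional.complete ℝ E
  have : CompleteSpace F := FiniteDimensional.complete ℝ F
  set L := fderiv ℝ f x
  obtain ⟨p, hp⟩ := Submodule.ClosedComplemented.of_finiteDimensional (𝕜 := ℝ) L.ker
  have hfx : ContDiffAt ℝ ∞ f x := hf.contDiffAt (hU.mem_nhds hx)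
  let k := Module.finrank ℝ L.ker
  have hk : k + Module.finrank ℝ F = Module.finrank ℝ E := by
    have h := L.toLinearMap.finrank_range_add_finrank_ker
    rw [hsurj, finrank_top] at h
    rw [← h, add_comm]
  let l : L.ker ≃L[ℝ] EuclideanSpace ℝ (Fin k) := ContinuousLinearEquiv.ofFinrankEq (by simp [k])
  let q : E →L[ℝ] EuclideanSpace ℝ (Fin k) := (l : L.ker →L[ℝ] _).comp p
  have hq (y : L.ker) : q y = l y := congrArg l (hp y)
  let G : E → F × EuclideanSpace ℝ (Fin k) := fun y => (f y, q y)
  have hG : ContDiffOn ℝ ∞ G U := hf.prodMk q.contDiff.contDiffOn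
  have hinj : (L.prod q).ker = ⊥ := by
    refine (Submodule.eq_bot_iff _).2 fun y hy => ?_
    have h1 : L y = 0 := congrArg Prod.fst (show (L.prod q) y = 0 from hy)
    have h2 : q y = 0 := congrArg Prod.snd (show (L.prod q) y = 0 from hy)
    have h3 : l ⟨y, h1⟩ = 0 := (hq ⟨y, h1⟩).symm.trans h2
    exact congrArg Subtype.val (l.map_eq_zero_iff.1 h3)
  have hrange : (L.prod q).range = ⊤ := by
    refine LinearMap.range_eq_top.2 fun ⟨a, b⟩ => ?_
    obtain ⟨y, hy⟩ := LinearMap.range_eq_top.1 hsurj a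
    let z : L.ker := l.symm (b - q y)
    have hz : L (z : E) = 0 := z.2
    have hy' : L y = a := hy
    refine ⟨y + z, Prod.ext ?_ ?_⟩
    · change L (y + z) = a
      rw [map_add, hz, hy', add_zero]
    · change q (y + z) = b
      rw [map_add, hq, l.apply_symm_apply]; abel
  let e : E ≃L[ℝ] F × EuclideanSpace ℝ (Fin k) :=
    ContinuousLinearEquiv.ofBijective (L.prod q) hinj hrange
  have hGx : HasFDerivAt G (e : E →L[ℝ] F × EuclideanSpace ℝ (Fin k)) x := by
    rw [ContinuousLinearEquiv.coe_ofBijective]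
    exact (hfx.differentiableAt (by simp)).hasFDerivAt.prodMk q.hasFDerivAt
  have hGx' : ContDiffAt ℝ ∞ G x := hG.contDiffAt (hU.mem_nhds hx)
  let Φ₀ := hGx'.toOpenPartialHomeomorph G hGx (by simp)
  -- Keeping the derivative of `G` invertible makes the inverse smooth on the whole target, not just
  -- at the image of `x`.
  let U' := U ∩ fderiv ℝ G ⁻¹' (range ((↑) : (E ≃L[ℝ] F × EuclideanSpace ℝ (Fin k)) → E →L[ℝ] _))
  have hU' : IsOpen U' :=
    (hG.continuousOn_fderiv_of_isOpen hU (by simp)).isOpen_inter_preimage hU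
      ContinuousLinearEquiv.isOpen
  refine ⟨k, hk, Φ₀.restrOpen U' hU', ?_, ?_, fun y => rfl, ?_, ?_⟩
  · exact ⟨hGx'.mem_toOpenPartialHomeomorph_source hGx (by simp), hx, e, hGx.fderiv.symm⟩
  · exact fun y hy => hy.2.1
  · exact hG.mono fun y hy => hy.2.1
  · intro y hy
    have hy' := (Φ₀.restrOpen U' hU').map_target hy
    obtain ⟨hyU, e', he'⟩ := hy'.2
    have hGy : ContDiffAt ℝ ∞ G ((Φ₀.restrOpen U' hU').symm y) :=
      hG.contDiffAt (hU.mem_nhds hyU)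
    refine ((Φ₀.restrOpen U' hU').contDiffAt_symm hy (f₀' := e') ?_ hGy).contDiffWithinAt
    rw [he']
    exact (hGy.differentiableAt (by simp)).hasFDerivAt

namespace SmMan

/-! ### Testing the universal property on Euclidean spaces -/

/-- Euclidean space as an object of `SmMan`, in any universe. -/
theorem exists_euclidean (n : ℕ) :
    ∃ (T : SmMan.{u}) (i : T → EuclideanSpace ℝ (Fin n)) (j : EuclideanSpace ℝ (Fin n) → T),
      ContMDiff (𝓡 T.dim) (𝓡 n) ∞ i ∧ ContMDiff (𝓡 n) (𝓡 T.dim) ∞ j ∧ ∀ x, i (j x) = x := by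
  let X := ULift.{u} (EuclideanSpace ℝ (Fin n))
  have ho : IsOpenEmbedding (ULift.down : X → EuclideanSpace ℝ (Fin n)) :=
    Homeomorph.ulift.isOpenEmbedding
  let := ho.singletonChartedSpace
  have : IsManifold (𝓡 n) ∞ X := ho.isManifold_singleton
  have : SecondCountableTopology X := Homeomorph.ulift.secondCountableTopology
  have : Nonempty X := ⟨⟨0⟩⟩
  refine ⟨{ carrier := X, dim := n }, ULift.down, ULift.up, contMDiff_isOpenEmbedding ho, ?_,
    fun x => rfl⟩
  refine ContMDiff.of_comp_isOpenEmbedding ho ?_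
  exact contMDiff_id

/-- Points of a pullback are determined by their projections. -/
theorem pullback_point_ext {A B C P : SmMan.{u}} {r : A ⟶ B} {f : C ⟶ B} {π₀ : P ⟶ A}
    {π₁ : P ⟶ C} (hP : IsPullback π₀ π₁ r f) {p p' : P} (h₀ : π₀.toFun p = π₀.toFun p')
    (h₁ : π₁.toFun p = π₁.toFun p') : p = p' := by
  let k (x : P) : P ⟶ P := Hom.mk (fun _ => x) contMDiff_const
  have h : k p = k p' := by
    refine hP.hom_ext (Hom.ext ?_) (Hom.ext ?_)
    · exact funext fun _ => h₀
    · exact funext fun _ => h₁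
  exact congrFun (congrArg Hom.toFun h) p

/-- A compatible pair of smooth maps out of a Euclidean space lifts to the pullback. -/
theorem exists_pullback_lift {A B C P : SmMan.{u}} {r : A ⟶ B} {f : C ⟶ B} {π₀ : P ⟶ A}
    {π₁ : P ⟶ C} (hP : IsPullback π₀ π₁ r f) {n : ℕ} {g : EuclideanSpace ℝ (Fin n) → A}
    {h : EuclideanSpace ℝ (Fin n) → C} (hg : ContMDiff (𝓡 n) (𝓡 A.dim) ∞ g)
    (hh : ContMDiff (𝓡 n) (𝓡 C.dim) ∞ h) (hgh : ∀ x, r.toFun (g x) = f.toFun (h x)) :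
    ∃ l : EuclideanSpace ℝ (Fin n) → P, ContMDiff (𝓡 n) (𝓡 P.dim) ∞ l ∧
      (∀ x, π₀.toFun (l x) = g x) ∧ ∀ x, π₁.toFun (l x) = h x := by
  obtain ⟨T, i, j, hi, hj, hij⟩ := exists_euclidean.{u} n
  let g' : T ⟶ A := Hom.mk (g ∘ i) (hg.comp hi)
  let h' : T ⟶ C := Hom.mk (h ∘ i) (hh.comp hi)
  have w : g' ≫ r = h' ≫ f := Hom.ext (funext fun x => hgh (i x))
  refine ⟨(hP.lift g' h' w).toFun ∘ j, (hP.lift g' h' w).contMDiff.comp hj, fun x => ?_,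
    fun x => ?_⟩
  · refine (congrFun (congrArg Hom.toFun (hP.lift_fst g' h' w)) (j x)).trans ?_
    change g (i (j x)) = g x
    rw [hij]
  · refine (congrFun (congrArg Hom.toFun (hP.lift_snd g' h' w)) (j x)).trans ?_
    change h (i (j x)) = h x
    rw [hij]

/-- Locally inverse differentiable maps exist only between manifolds of the same dimension. -/
theorem dim_eq_of_local_inverse {P : SmMan.{u}} {n : ℕ} {a : EuclideanSpace ℝ (Fin n) → P}
    {b : P → EuclideanSpace ℝ (Fin n)} {p : P} (ha : ContMDiff (𝓡 n) (𝓡 P.dim) ∞ a)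
    (hb : ContMDiffAt (𝓡 P.dim) (𝓡 n) ∞ b p) (hba : ∀ x, b (a x) = x)
    (hab : ∀ᶠ y in 𝓝 p, a (b y) = y) : P.dim = n := by
  have hp : a (b p) = p := hab.self_of_nhds
  have hda : HasMFDerivAt (𝓡 n) (𝓡 P.dim) a (b p) (mfderiv (𝓡 n) (𝓡 P.dim) a (b p)) :=
    (ha.mdifferentiable (by simp) _).hasMFDerivAt
  have hdb : HasMFDerivAt (𝓡 P.dim) (𝓡 n) b p (mfderiv (𝓡 P.dim) (𝓡 n) b p) :=
    (hb.mdifferentiableAt (by simp)).hasMFDerivAt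
  have hdb' : HasMFDerivAt (𝓡 P.dim) (𝓡 n) b (a (b p)) (mfderiv (𝓡 P.dim) (𝓡 n) b p) := by
    rw [hp]; exact hdb
  have h1 := hasMFDerivAt_unique (hdb'.comp (b p) hda)
    ((hasMFDerivAt_id (I := 𝓡 n) (b p)).congr_of_eventuallyEq (.of_forall hba))
  have h2 := hasMFDerivAt_unique (hda.comp p hdb)
    ((hasMFDerivAt_id (I := 𝓡 P.dim) p).congr_of_eventuallyEq hab)
  let e : EuclideanSpace ℝ (Fin n) ≃ₗ[ℝ] EuclideanSpace ℝ (Fin P.dim) :=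
    LinearEquiv.ofLinearMap (mfderiv (𝓡 n) (𝓡 P.dim) a (b p)).toLinearMap
      (mfderiv (𝓡 P.dim) (𝓡 n) b p).toLinearMap
      (LinearMap.ext fun v => congrArg (fun T => T v) h2)
      (LinearMap.ext fun v => congrArg (fun T => T v) h1)
  simpa using e.finrank_eq.symm

/-- A pullback has dimension `n` if near some point it has a smooth parametrization by an open
subset of `ℝ^n` with a smooth inverse. -/
theorem pullback_dim_eq_of_local_parametrization {A B C P : SmMan.{u}} {r : A ⟶ B} {f : C ⟶ B}
    {π₀ : P ⟶ A} {π₁ : P ⟶ C} (hP : IsPullback π₀ π₁ r f) {n : ℕ}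
    {N : Set (EuclideanSpace ℝ (Fin n))} (hN : IsOpen N) {g : EuclideanSpace ℝ (Fin n) → A}
    {h : EuclideanSpace ℝ (Fin n) → C} (hg : ContMDiffOn (𝓡 n) (𝓡 A.dim) ∞ g N)
    (hh : ContMDiffOn (𝓡 n) (𝓡 C.dim) ∞ h N) (hgh : ∀ x ∈ N, r.toFun (g x) = f.toFun (h x))
    {b : P → EuclideanSpace ℝ (Fin n)} {p : P} (hp : b p ∈ N)
    (hb : ContMDiffAt (𝓡 P.dim) (𝓡 n) ∞ b p)
    (hbN : ∀ y, ∀ x ∈ N, π₀.toFun y = g x → π₁.toFun y = h x → b y = x)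
    (hNb : ∀ᶠ y in 𝓝 p, g (b y) = π₀.toFun y ∧ h (b y) = π₁.toFun y) :
    P.dim = n := by
  -- The lift needs maps defined on all of `ℝ^n`, so a ball inside `N` is reparametrized by `ℝ^n`.
  obtain ⟨ε, hε, hball⟩ := Metric.isOpen_iff.1 hN _ hp
  let σ := OpenPartialHomeomorph.univBall (b p) ε
  have hσ : ContDiff ℝ ∞ σ := OpenPartialHomeomorph.contDiff_univBall
  have hσt : σ.target = Metric.ball (b p) ε := OpenPartialHomeomorph.univBall_target _ hε
  have hσs : σ.source = univ := OpenPartialHomeomorph.univBall_source _ _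
  have hσN (x) : σ x ∈ N := hball (hσt ▸ σ.map_source (hσs ▸ mem_univ x))
  obtain ⟨l, hl, hl₀, hl₁⟩ := exists_pullback_lift hP (hg.comp_contMDiff hσ.contMDiff hσN)
    (hh.comp_contMDiff hσ.contMDiff hσN) fun x => hgh _ (hσN x)
  have hσ' : ContMDiffAt (𝓡 n) (𝓡 n) ∞ σ.symm (b p) :=
    (OpenPartialHomeomorph.contDiffOn_univBall_symm.contDiffAt
      (Metric.ball_mem_nhds _ hε)).contMDiffAt
  refine dim_eq_of_local_inverse hl (hσ'.comp p hb) (fun x => ?_) ?_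
  · change σ.symm (b (l x)) = x
    rw [hbN (l x) (σ x) (hσN x) (hl₀ x) (hl₁ x)]
    exact σ.left_inv (hσs ▸ mem_univ x)
  · filter_upwards [hNb, hb.continuousAt.preimage_mem_nhds (Metric.ball_mem_nhds _ hε)]
      with y hy hyb
    have hr : σ (σ.symm (b y)) = b y := σ.right_inv (hσt ▸ hyb)
    refine pullback_point_ext hP ((hl₀ _).trans ?_) ((hl₁ _).trans ?_)
    · change g (σ (σ.symm (b y))) = _
      rw [hr, hy.1]
    · change h (σ (σ.symm (b y))) = _
      rw [hr, hy.2]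


/-! ### Retractions near a section -/

/-- A retraction is a submersion along the image of a section: near such a point it is, in
suitable coordinates, the first projection of a product. -/
theorem exists_local_product_of_section {A B : SmMan.{u}} {r : A ⟶ B} {s : B ⟶ A}
    (hsr : s ≫ r = 𝟙 B) (b : B) :
    ∃ k : ℕ, k + B.dim = A.dim ∧ ∃ (O : Set A) (q : A → EuclideanSpace ℝ (Fin k))
      (W : Set (EuclideanSpace ℝ (Fin B.dim) × EuclideanSpace ℝ (Fin k)))
      (ψ : EuclideanSpace ℝ (Fin B.dim) × EuclideanSpace ℝ (Fin k) → A),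
      IsOpen O ∧ s.toFun b ∈ O ∧ IsOpen W ∧ ContMDiffOn (𝓡 A.dim) (𝓡 k) ∞ q O ∧
      ContMDiffOn 𝓘(ℝ, EuclideanSpace ℝ (Fin B.dim) × EuclideanSpace ℝ (Fin k)) (𝓡 A.dim) ∞ ψ W ∧
      (∀ w ∈ W, r.toFun (ψ w) ∈ (extChartAt (𝓡 B.dim) b).source ∧
        extChartAt (𝓡 B.dim) b (r.toFun (ψ w)) = w.1 ∧ q (ψ w) = w.2) ∧
      ∀ a ∈ O, (extChartAt (𝓡 B.dim) b (r.toFun a), q a) ∈ W ∧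
        ψ (extChartAt (𝓡 B.dim) b (r.toFun a), q a) = a := by
  have hrs (y : B) : r.toFun (s.toFun y) = y := congrFun (congrArg Hom.toFun hsr) y
  set a := s.toFun b with ha
  let φ := extChartAt (𝓡 A.dim) a
  let χ := extChartAt (𝓡 B.dim) b
  have hφs : ContMDiffOn (𝓡 A.dim) 𝓘(ℝ, EuclideanSpace ℝ (Fin A.dim)) ∞ φ φ.source := by
    simpa only [φ, extChartAt_source] using contMDiffOn_extChartAt (I := 𝓡 A.dim) (n := ∞) (x := a)
  have hχs : ContMDiffOn (𝓡 B.dim) 𝓘(ℝ, EuclideanSpace ℝ (Fin B.dim)) ∞ χ χ.source := by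
    simpa only [χ, extChartAt_source] using contMDiffOn_extChartAt (I := 𝓡 B.dim) (n := ∞) (x := b)
  have hφt : ContMDiffOn 𝓘(ℝ, EuclideanSpace ℝ (Fin A.dim)) (𝓡 A.dim) ∞ φ.symm φ.target :=
    contMDiffOn_extChartAt_symm a
  have hχt : ContMDiffOn 𝓘(ℝ, EuclideanSpace ℝ (Fin B.dim)) (𝓡 B.dim) ∞ χ.symm χ.target :=
    contMDiffOn_extChartAt_symm b
  let U := φ.target ∩ φ.symm ⁻¹' (r.toFun ⁻¹' χ.source)
  have hU : IsOpen U := hφt.continuousOn.isOpen_inter_preimage (isOpen_extChartAt_target a)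
    ((isOpen_extChartAt_source b).preimage r.contMDiff.continuous)
  have haφ : a ∈ φ.source := mem_extChartAt_source a
  have hbχ : b ∈ χ.source := mem_extChartAt_source b
  have hxU : φ a ∈ U := by
    refine ⟨φ.map_source haφ, ?_⟩
    change r.toFun (φ.symm (φ a)) ∈ χ.source
    rw [φ.left_inv haφ, ha, hrs]
    exact hbχ
  let ρ := χ ∘ r.toFun ∘ φ.symm
  have hρ : ContDiffOn ℝ ∞ ρ U := contMDiffOn_iff_contDiffOn.1 <|
    hχs.comp (r.contMDiff.comp_contMDiffOn (hφt.mono inter_subset_left)) fun x hx => hx.2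
  -- `σ` is the section in charts. Differentiating `ρ ∘ σ = id` near `χ b` gives a right inverse of
  -- the derivative of `ρ`.
  let σ := φ ∘ s.toFun ∘ χ.symm
  have hχb : χ.symm (χ b) = b := χ.left_inv hbχ
  have hσb : σ (χ b) = φ a := by simp only [σ, Function.comp_apply, hχb, ha]
  have hσ : ContMDiffAt 𝓘(ℝ, EuclideanSpace ℝ (Fin B.dim)) 𝓘(ℝ, EuclideanSpace ℝ (Fin A.dim)) ∞ σ
      (χ b) := by
    have h1 : ContMDiffAt 𝓘(ℝ, EuclideanSpace ℝ (Fin B.dim)) (𝓡 A.dim) ∞ (s.toFun ∘ χ.symm)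
        (χ b) := s.contMDiff.contMDiffAt.comp _
      (hχt.contMDiffAt ((isOpen_extChartAt_target b).mem_nhds (χ.map_source hbχ)))
    refine ContMDiffAt.comp _ (hφs.contMDiffAt ((isOpen_extChartAt_source a).mem_nhds ?_)) h1
    simpa only [Function.comp_apply, hχb] using haφ
  have hρσ : ρ ∘ σ =ᶠ[𝓝 (χ b)] id := by
    have h2 : ∀ᶠ y in 𝓝 (χ b), s.toFun (χ.symm y) ∈ φ.source := by
      refine (s.contMDiff.continuous.continuousAt.comp
        (continuousAt_extChartAt_symm b)).preimage_mem_nhds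
        ((isOpen_extChartAt_source a).mem_nhds ?_)
      change s.toFun (χ.symm (χ b)) ∈ φ.source
      rwa [hχb]
    filter_upwards [h2, (isOpen_extChartAt_target b).mem_nhds (χ.map_source hbχ)] with y hy hyt
    change χ (r.toFun (φ.symm (φ (s.toFun (χ.symm y))))) = y
    rw [φ.left_inv hy, hrs]
    exact χ.right_inv hyt
  have hsurj : (fderiv ℝ ρ (φ a)).range = ⊤ := by
    have hdσ := (hσ.contDiffAt.differentiableAt (by simp)).hasFDerivAt
    have hdρ : HasFDerivAt ρ (fderiv ℝ ρ (φ a)) (σ (χ b)) := by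
      rw [hσb]
      exact ((hρ.contDiffAt (hU.mem_nhds hxU)).differentiableAt (by simp)).hasFDerivAt
    have h := (hdρ.comp (χ b) hdσ).unique ((hasFDerivAt_id (χ b)).congr_of_eventuallyEq hρσ)
    exact LinearMap.range_eq_top.2 fun v => ⟨_, congrArg (fun T => T v) h⟩
  obtain ⟨k, hk, Φ, hxΦ, hΦU, hΦρ, hΦ, hΦ'⟩ :=
    exists_smooth_coordinates_of_surjective_fderiv hU hxU hρ hsurj
  have hmap {w} (hw : w ∈ Φ.target) : Φ.symm w ∈ U := hΦU (Φ.map_target hw)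
  have hOs : ContMDiffOn (𝓡 A.dim)
      𝓘(ℝ, EuclideanSpace ℝ (Fin B.dim) × EuclideanSpace ℝ (Fin k)) ∞ (Φ ∘ φ)
      (φ.source ∩ φ ⁻¹' Φ.source) :=
    hΦ.contMDiffOn.comp (hφs.mono inter_subset_left) fun y hy => hy.2
  refine ⟨k, by simpa using hk, φ.source ∩ φ ⁻¹' Φ.source, fun y => (Φ (φ y)).2, Φ.target,
    φ.symm ∘ Φ.symm, ?_, ⟨haφ, hxΦ⟩, Φ.open_target, ?_, ?_, ?_, ?_⟩
  · exact hφs.continuousOn.isOpen_inter_preimage (isOpen_extChartAt_source a) Φ.open_source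
  · exact contDiff_snd.contMDiff.comp_contMDiffOn hOs
  · exact hφt.comp hΦ'.contMDiffOn fun w hw => (hmap hw).1
  · intro w hw
    refine ⟨(hmap hw).2, ?_, ?_⟩
    · change ρ (Φ.symm w) = w.1
      rw [← hΦρ, Φ.right_inv hw]
    · change (Φ (φ (φ.symm (Φ.symm w)))).2 = w.2
      rw [φ.right_inv (hmap hw).1, Φ.right_inv hw]
  · rintro y ⟨hy, hy'⟩
    have h : (χ (r.toFun y), (Φ (φ y)).2) = Φ (φ y) := by
      refine Prod.ext ?_ rfl
      rw [hΦρ]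
      change χ (r.toFun y) = χ (r.toFun (φ.symm (φ y)))
      rw [φ.left_inv hy]
    change (χ (r.toFun y), (Φ (φ y)).2) ∈ _ ∧ φ.symm (Φ.symm (χ (r.toFun y), (Φ (φ y)).2)) = y
    rw [h]
    exact ⟨Φ.map_source hy', by rw [Φ.left_inv hy', φ.left_inv hy]⟩

end SmMan

/-! ### The dimension count -/

theorem mainTheorem11 {A B C P : SmMan.{u}} (r : A ⟶ B) (hr : ∃ s : B ⟶ A, s ≫ r = 𝟙 B)
    (f : C ⟶ B) (hC : Nonempty C) (π₀ : P ⟶ A) (π₁ : P ⟶ C) (hP : IsPullback π₀ π₁ r f) :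
    (P.dim : ℤ) = (A.dim : ℤ) + (C.dim : ℤ) - (B.dim : ℤ) := by
  obtain ⟨s, hsr⟩ := hr
  obtain ⟨c⟩ := hC
  have hcomm (y : P) : r.toFun (π₀.toFun y) = f.toFun (π₁.toFun y) :=
    congrFun (congrArg SmMan.Hom.toFun hP.w) y
  have hw : (f ≫ s) ≫ r = 𝟙 C ≫ f := by
    rw [Category.assoc, hsr, Category.comp_id, Category.id_comp]
  let p : P := (hP.lift (f ≫ s) (𝟙 C) hw).toFun c
  have hp₀ : π₀.toFun p = s.toFun (f.toFun c) :=
    congrFun (congrArg SmMan.Hom.toFun (hP.lift_fst (f ≫ s) (𝟙 C) hw)) c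
  have hp₁ : π₁.toFun p = c :=
    congrFun (congrArg SmMan.Hom.toFun (hP.lift_snd (f ≫ s) (𝟙 C) hw)) c
  obtain ⟨k, hk, O, q, W, ψ, hO, hcO, hW, hq, hψ, hψW, hψO⟩ :=
    SmMan.exists_local_product_of_section hsr (f.toFun c)
  let χ := extChartAt (𝓡 B.dim) (f.toFun c)
  let η := extChartAt (𝓡 C.dim) c
  have hχs : ContMDiffOn (𝓡 B.dim) 𝓘(ℝ, EuclideanSpace ℝ (Fin B.dim)) ∞ χ χ.source := by
    simpa only [χ, extChartAt_source] using
      contMDiffOn_extChartAt (I := 𝓡 B.dim) (n := ∞) (x := f.toFun c)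
  have hηt : ContMDiffOn 𝓘(ℝ, EuclideanSpace ℝ (Fin C.dim)) (𝓡 C.dim) ∞ η.symm η.target :=
    contMDiffOn_extChartAt_symm c
  have hcη : c ∈ η.source := mem_extChartAt_source c
  let e : EuclideanSpace ℝ (Fin (C.dim + k)) ≃L[ℝ]
      EuclideanSpace ℝ (Fin C.dim) × EuclideanSpace ℝ (Fin k) :=
    ContinuousLinearEquiv.ofFinrankEq (by simp)
  let h : EuclideanSpace ℝ (Fin (C.dim + k)) → C := fun x => η.symm (e x).1
  -- Product coordinates of the point of `A`: the base part is forced by `f`, the fibre part is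
  -- free.
  let m : EuclideanSpace ℝ (Fin (C.dim + k)) →
      EuclideanSpace ℝ (Fin B.dim) × EuclideanSpace ℝ (Fin k) :=
    fun x => (χ (f.toFun (h x)), (e x).2)
  let N₁ := (fun x => (e x).1) ⁻¹' η.target
  have hN₁ : IsOpen N₁ :=
    (isOpen_extChartAt_target c).preimage (continuous_fst.comp e.continuous)
  have hh : ContMDiffOn (𝓡 (C.dim + k)) (𝓡 C.dim) ∞ h N₁ :=
    hηt.comp (contDiff_fst.comp e.contDiff).contMDiff.contMDiffOn fun x hx => hx
  let N₂ := N₁ ∩ h ⁻¹' (f.toFun ⁻¹' χ.source)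
  have hN₂ : IsOpen N₂ := hh.continuousOn.isOpen_inter_preimage hN₁
    ((isOpen_extChartAt_source _).preimage f.contMDiff.continuous)
  have hm : ContMDiffOn (𝓡 (C.dim + k))
      𝓘(ℝ, EuclideanSpace ℝ (Fin B.dim) × EuclideanSpace ℝ (Fin k)) ∞ m N₂ :=
    (hχs.comp (f.contMDiff.comp_contMDiffOn (hh.mono inter_subset_left))
      fun x hx => hx.2).prodMk_space (contDiff_snd.comp e.contDiff).contMDiff.contMDiffOn
  let N := N₂ ∩ m ⁻¹' W
  have hN : IsOpen N := hm.continuousOn.isOpen_inter_preimage hN₂ hW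
  let b : P → EuclideanSpace ℝ (Fin (C.dim + k)) :=
    fun y => e.symm (η (π₁.toFun y), q (π₀.toFun y))
  have heb (y : P) : e (b y) = (η (π₁.toFun y), q (π₀.toFun y)) := e.apply_symm_apply _
  have hhb (y : P) (hy : π₁.toFun y ∈ η.source) : h (b y) = π₁.toFun y := by
    simp only [h, heb]
    exact η.left_inv hy
  have hmb (y : P) (hy : π₁.toFun y ∈ η.source) :
      m (b y) = (χ (r.toFun (π₀.toFun y)), q (π₀.toFun y)) := by
    simp only [m, hhb y hy, heb, hcomm]
  have hpη : π₁.toFun p ∈ η.source := hp₁.symm ▸ hcη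
  have hpO : π₀.toFun p ∈ O := hp₀.symm ▸ hcO
  have hpN : b p ∈ N := by
    refine ⟨⟨?_, ?_⟩, ?_⟩
    · change (e (b p)).1 ∈ η.target
      rw [heb]
      exact η.map_source hpη
    · change f.toFun (h (b p)) ∈ χ.source
      rw [hhb p hpη, hp₁]
      exact mem_extChartAt_source _
    · change m (b p) ∈ W
      rw [hmb p hpη]
      exact (hψO _ hpO).1
  have hb : ContMDiffAt (𝓡 P.dim) (𝓡 (C.dim + k)) ∞ b p := by
    have h₁ : ContMDiffAt (𝓡 P.dim) (𝓡 C.dim) ∞ (fun y => η (π₁.toFun y)) p :=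
      (contMDiffAt_extChartAt' (by simpa only [η, extChartAt_source] using hpη)).comp p
        π₁.contMDiff.contMDiffAt
    have h₀ : ContMDiffAt (𝓡 P.dim) (𝓡 k) ∞ (fun y => q (π₀.toFun y)) p :=
      (hq.contMDiffAt (hO.mem_nhds hpO)).comp p π₀.contMDiff.contMDiffAt
    exact e.symm.contDiff.contMDiff.contMDiffAt.comp p (h₁.prodMk_space h₀)
  have hdim : P.dim = C.dim + k := by
    refine SmMan.pullback_dim_eq_of_local_parametrization hP hN (g := ψ ∘ m) (h := h)
      (hψ.comp (hm.mono inter_subset_left) fun x hx => hx.2)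
      (hh.mono fun x hx => hx.1.1) (fun x hx => ?_) hpN hb (fun y x hx h₀ h₁ => ?_) ?_
    · obtain ⟨h1, h2, -⟩ := hψW _ hx.2
      -- Equal coordinates give equal points only inside the chart domain, hence the condition built
      -- into `N₂`.
      exact χ.injOn h1 hx.1.2 h2
    · refine e.injective ((heb y).trans (Prod.ext ?_ ?_))
      · rw [h₁]
        exact η.right_inv hx.1.1
      · rw [h₀]
        exact (hψW _ hx.2).2.2
    · filter_upwards [((isOpen_extChartAt_source c).preimage π₁.contMDiff.continuous).mem_nhds hpη,
        (hO.preimage π₀.contMDiff.continuous).mem_nhds hpO] with y hy₁ hy₀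
      refine ⟨?_, hhb y hy₁⟩
      change ψ (m (b y)) = _
      rw [hmb y hy₁]
      exact (hψO _ hy₀).2
  omega
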